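/- **Theorem.** Let $\sigma:\mathbb{R}\to\mathbb{R}$ be a non-decreasing sigmoidal function, i.e. $\lim_{x\to-\infty}\sigma(x)=0$ and $\lim_{x\to+\infty}\sigma(x)=1$, such that * ($\Sigma1$) $\sigma-\tfrac12$ is an odd function; * ($\Sigma2$) $\sigma\in C^2(\mathbb{R})$ and $\sigma$ is concave on $[0,+\infty)$; * ($\Sigma3$) $\sigma(x)=\mathcal{O}(|x|^{-1-\alpha})$ as $x\to-\infty$, for some $\alpha>1$. Put $\phi_\sigma(x)=\tfrac12[\sigma(x+1)-\sigma(x-1)]$ for $x\in\mathbb{R}$ and $\Psi_\sigma(x)=\phi_\sigma(x_1)\phi_\sigma(x_2)$ for $x=(x_1,x_2)\in\mathbb{R}^2$. Let $I=[a_1,b_1]\times[a_2,b_2]$ with $a_i<b_i$, let $\mathcal{A}_n=\{k\in\mathbb{Z}^2:\lceil na_i\rceil\le k_i\le\lfloor nb_i\rfloor,\ i=1,2\}$, and define the bivariate neural network operators $$F_n(f,x)=\frac{\sum_{k\in\mathcal{A}_n}f(k/n)\,\Psi_\sigma(nx-k)}{\sum_{k\in\mathcal{A}_n}\Psi_\sigma(nx-k)},\qquad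 x\in I.$$ Let $M(I)$ be the set of all bounded (Lebesgue) measurable functions $f:I\to\mathbb{R}$. For $f\in M(I)$, $\delta>0$, $x\in I$ and $1\le p\le\infty$ let $$\omega(f,x;\delta)=\sup\bigl\{|f(u+h)-f(u)|:\ 0<|h|\le\delta,\ u,u+h\in I,\ \|u-x\|_m\le\tfrac{\delta}{2},\ \|u+h-x\|_m\le\tfrac{\delta}{2}\bigr\},$$ $$\tau(f,\delta)_p=\|\omega(f,\cdot\,;\delta)\|_{L^p(I)},\qquad \omega(f,\delta)=\sup\{|f(u)-f(v)|:\ u,v\in I,\ |u-v|\le\delta\},$$ where $|\cdot|$ is the Euclidean norm and $\|\cdot\|_m$ the maximum norm of $\mathbb{R}^2$. Then there are a constant $C>0$ and an $N\in\mathbb{N}$, depending neither on $f$ nor on $p$, such that for every $f\in M(I)$ and every $n\ge N$ $$\|F_n(f,\cdot)-f\|_{L^p(I)}\le C\,\tau(f,n^{-1/4})_p\qquad\text{for all }1\le p\le\infty,$$ and moreover, in the supremum norm, $$\sup_{x\in I}|F_n(f,x)-f(x)|\le C\,\omega(f,n^{-1/4}).$$ -/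

import Mathlib

open MeasureTheory Filter Topology Asymptotics
open scoped ENNReal

noncomputable section

namespace NNOp

/-- A sigmoidal function: limit `0` at `-∞` and limit `1` at `+∞`. -/
def IsSigmoidal (σ : ℝ → ℝ) : Prop :=
  Tendsto σ atBot (𝓝 0) ∧ Tendsto σ atTop (𝓝 1)

/-- The standing assumptions on `σ` other than the decay condition: `σ` is a non-decreasing
sigmoidal function, `σ - 1/2` is odd, `σ` is of class `C²` and is concave on `[0, ∞)`. -/
structure Admissible (σ : ℝ → ℝ) : Prop where
  sigmoidal : IsSigmoidal σ
  monotone : Monotone σ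
  odd : ∀ x, σ (-x) - 1 / 2 = -(σ x - 1 / 2)
  contDiff : ContDiff ℝ 2 σ
  concave : ConcaveOn ℝ (Set.Ici 0) σ

/-- The decay condition `σ(x) = O(|x|^(-1-α))` as `x → -∞`. -/
def Decay (σ : ℝ → ℝ) (α : ℝ) : Prop :=
  σ =O[atBot] fun x : ℝ => |x| ^ (-1 - α)

/-- The univariate density function `φ_σ(x) = (σ(x+1) - σ(x-1)) / 2`. -/
def phi (σ : ℝ → ℝ) (x : ℝ) : ℝ :=
  (1 / 2) * (σ (x + 1) - σ (x - 1))

/-- The bivariate density function `Ψ_σ(x) = φ_σ(x₁) φ_σ(x₂)`. -/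
def Psi (σ : ℝ → ℝ) (x : Fin 2 → ℝ) : ℝ :=
  ∏ i, phi σ (x i)

/-- The index set of all `k ∈ ℤ²` with `⌈n aᵢ⌉ ≤ kᵢ ≤ ⌊n bᵢ⌋` for `i = 1, 2`. -/
def indexSet (a b : Fin 2 → ℝ) (n : ℕ) : Finset (Fin 2 → ℤ) :=
  Fintype.piFinset fun i => Finset.Icc ⌈(n : ℝ) * a i⌉ ⌊(n : ℝ) * b i⌋

/-- The neural network operator `F_n(f, x)` on the rectangle `I = Set.Icc a b`. Only the values of
`f` at the nodes `k / n`, which lie in `I`, enter. -/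
def nnOperator (σ : ℝ → ℝ) (a b : Fin 2 → ℝ) (n : ℕ) (f : (Fin 2 → ℝ) → ℝ) (x : Fin 2 → ℝ) : ℝ :=
  (∑ k ∈ indexSet a b n, f (fun i => (k i : ℝ) / n) * Psi σ (fun i => (n : ℝ) * x i - k i)) /
    ∑ k ∈ indexSet a b n, Psi σ (fun i => (n : ℝ) * x i - k i)

/-- `M(I)`: functions that are bounded and Lebesgue measurable on `I = Set.Icc a b`. A function on
`I` is represented by a function on the plane of which only the values on `I` matter. -/
def boundedMeasurable (a b : Fin 2 → ℝ) : Set ((Fin 2 → ℝ) → ℝ) :=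
  {f | AEMeasurable f (volume.restrict (Set.Icc a b)) ∧ ∃ B : ℝ, ∀ x ∈ Set.Icc a b, |f x| ≤ B}

/-- The Euclidean length of a vector of the plane. (The norm `‖h‖` of `Fin 2 → ℝ` in Mathlib is the
maximum norm.) -/
def euclNorm (h : Fin 2 → ℝ) : ℝ :=
  √(∑ i, h i ^ 2)

/-- The local modulus of smoothness `ω(f, x; δ)`: the supremum of `|f(u+h) - f(u)|` over
`0 < |h| ≤ δ` and `u, u + h` in `I` at maximum-norm distance at most `δ/2` from `x`. -/
def localModulus (a b : Fin 2 → ℝ) (f : (Fin 2 → ℝ) → ℝ) (δ : ℝ) (x : Fin 2 → ℝ) : ℝ :=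
  sSup {r | ∃ u h : Fin 2 → ℝ, 0 < euclNorm h ∧ euclNorm h ≤ δ ∧
    u ∈ Set.Icc a b ∧ u + h ∈ Set.Icc a b ∧ ‖u - x‖ ≤ δ / 2 ∧ ‖u + h - x‖ ≤ δ / 2 ∧
    r = |f (u + h) - f u|}

/-- The averaged modulus of smoothness `τ(f, δ)_p`: the `L^p(I)`-norm of `x ↦ ω(f, x; δ)`. -/
def tau (a b : Fin 2 → ℝ) (f : (Fin 2 → ℝ) → ℝ) (δ : ℝ) (p : ℝ≥0∞) : ℝ≥0∞ :=
  eLpNorm (localModulus a b f δ) p (volume.restrict (Set.Icc a b))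

/-- The classical modulus of continuity `ω(f, δ)` of `f` on `I`. -/
def modulus (a b : Fin 2 → ℝ) (f : (Fin 2 → ℝ) → ℝ) (δ : ℝ) : ℝ :=
  sSup {r | ∃ u ∈ Set.Icc a b, ∃ v ∈ Set.Icc a b, euclNorm (u - v) ≤ δ ∧ r = |f u - f v|}

end NNOp

end

namespace NNOp

/-! ### The density `phi`: positivity near the origin, decay, discrete moments. -/

namespace Admissible

variable {σ : ℝ → ℝ}

/-! The kernel weights have uniformly bounded first moments (`exists_sum_phi_le`) and a total
bounded below, so at most O(1/(nδ)) of the normalized mass lies at distance δ/2 or more from x. The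
error at x is thus at most the variation of f within δ/2 of x plus O(1/(nδ)) times the oscillation
of f on I (`exists_abs_nnOperator_sub_le`). A chain of O(1/δ) short steps bounds that oscillation
(`abs_sub_le_of_small_steps`), and each step is at most O(δ^(-2)) times the integral of the local
modulus (`abs_sub_mul_sq_le_lintegral`). The far part is therefore O(1/(nδ^4)) times this integral,
which is why δ = n^(-1/4); Hölder's inequality returns it to the L^p norm. In the supremum norm each
step is bounded directly by the modulus of continuity. -/

lemma nonneg (hσ : Admissible σ) (x : ℝ) : 0 ≤ σ x :=
  hσ.monotone.le_of_tendsto hσ.sigmoidal.1 x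

lemma le_one (hσ : Admissible σ) (x : ℝ) : σ x ≤ 1 :=
  hσ.monotone.ge_of_tendsto hσ.sigmoidal.2 x

lemma map_zero (hσ : Admissible σ) : σ 0 = 1 / 2 := by
  have := hσ.odd 0
  rw [neg_zero] at this
  linarith

lemma map_neg (hσ : Admissible σ) (x : ℝ) : σ (-x) = 1 - σ x := by
  linarith [hσ.odd x]

/-- Concavity forces a non-constant `σ` to leave the value `1/2` immediately. -/
lemma half_lt_map_one (hσ : Admissible σ) : 1 / 2 < σ 1 := by
  by_contra! h
  have hle : ∀ x, 1 ≤ x → σ x ≤ 1 / 2 := by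
    intro x hx
    have hx0 : 0 < x := by linarith
    have hc := hσ.concave.2 (Set.mem_Ici.2 le_rfl) (Set.mem_Ici.2 hx0.le)
      (show 0 ≤ 1 - 1 / x by rw [sub_nonneg, div_le_one hx0]; exact hx)
      (show 0 ≤ 1 / x by positivity) (by ring)
    simp only [smul_eq_mul, mul_zero, zero_add, hσ.map_zero] at hc
    rw [one_div_mul_cancel hx0.ne'] at hc
    have h2 : 1 / x * (σ x - 1 / 2) ≤ 0 := by linarith
    by_contra! h3
    have : 0 < 1 / x * (σ x - 1 / 2) := mul_pos (by positivity) (by linarith)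
    linarith
  have := le_of_tendsto hσ.sigmoidal.2 (eventually_atTop.2 ⟨1, hle⟩)
  norm_num at this

lemma phi_nonneg (hσ : Admissible σ) (x : ℝ) : 0 ≤ phi σ x := by
  have := hσ.monotone (show x - 1 ≤ x + 1 by linarith)
  unfold phi
  linarith

lemma phi_le_one (hσ : Admissible σ) (x : ℝ) : phi σ x ≤ 1 := by
  unfold phi
  linarith [hσ.nonneg (x - 1), hσ.le_one (x + 1)]

lemma phi_neg (hσ : Admissible σ) (x : ℝ) : phi σ (-x) = phi σ x := by
  unfold phi
  have h1 := hσ.map_neg (x - 1)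
  have h2 := hσ.map_neg (x + 1)
  rw [show -(x - 1) = -x + 1 by ring] at h1
  rw [show -(x + 1) = -x - 1 by ring] at h2
  rw [h1, h2]
  ring

lemma phi_abs (hσ : Admissible σ) (x : ℝ) : phi σ |x| = phi σ x := by
  rcases abs_choice x with h | h <;> rw [h]
  exact hσ.phi_neg x

lemma le_phi (hσ : Admissible σ) {x : ℝ} (hx : |x| ≤ 1) :
    (1 / 2) * (σ 1 - 1 / 2) ≤ phi σ x := by
  rw [← hσ.phi_abs]
  unfold phi
  have h1 := hσ.monotone (show 1 ≤ |x| + 1 by linarith [abs_nonneg x])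
  have h2 := hσ.monotone (show |x| - 1 ≤ 0 by linarith)
  rw [hσ.map_zero] at h2
  linarith

/-- The decay of `σ` at `-∞` is inherited by `φ_σ`, uniformly on the line. -/
lemma exists_phi_le (hσ : Admissible σ) {α : ℝ} (hα : 1 < α) (hd : Decay σ α) :
    ∃ B : ℝ, 0 < B ∧ ∀ s, (1 + |s|) * phi σ s ≤ B * (1 + |s|) ^ (-α) := by
  obtain ⟨c, hc, hcb⟩ := hd.exists_pos
  obtain ⟨R, hR⟩ := eventually_atBot.1 hcb.bound
  -- Beyond 3, |s| - 1 ≥ (1 + |s|)/2; beyond 1 - R, the decay bound applies at 1 - |s|.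
  set M : ℝ := max 3 (-R + 1) with hM
  refine ⟨c * 2 ^ (1 + α) + (1 + M) ^ (1 + α), by positivity, fun s => ?_⟩
  have hs : 0 < 1 + |s| := by positivity
  have hpow : (1 + |s|) ^ (-α) = (1 + |s|) * (1 + |s|) ^ (-1 - α) := by
    rw [← Real.rpow_one_add' hs.le (by linarith)]
    ring_nf
  rw [hpow, mul_left_comm]
  refine mul_le_mul_of_nonneg_left ?_ hs.le
  rw [add_mul]
  have hM3 : 3 ≤ M := le_max_left _ _
  rcases le_total M |s| with h | h
  · have h1 : -|s| + 1 ≤ R := by linarith [le_max_right 3 (-R + 1)]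
    have h2 := hR _ h1
    rw [Real.norm_of_nonneg (hσ.nonneg _), Real.norm_of_nonneg (by positivity),
      abs_of_nonpos (a := -|s| + 1) (by linarith)] at h2
    have h3 : phi σ s ≤ σ (-|s| + 1) := by
      rw [← hσ.phi_abs, ← hσ.phi_neg]
      unfold phi
      linarith [hσ.nonneg (-|s| - 1), hσ.nonneg (-|s| + 1)]
    have h4 : (-(-|s| + 1)) ^ (-1 - α) ≤ ((1 + |s|) / 2) ^ (-1 - α) :=
      Real.rpow_le_rpow_of_nonpos (by positivity) (by linarith) (by linarith)
    have h5 : ((1 + |s|) / 2) ^ (-1 - α) = 2 ^ (1 + α) * (1 + |s|) ^ (-1 - α) := by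
      rw [Real.div_rpow hs.le (by norm_num), show -1 - α = -(1 + α) by ring,
        Real.rpow_neg (x := 2) (by norm_num), div_inv_eq_mul, mul_comm]
    have h6 : 0 ≤ (1 + M) ^ (1 + α) * (1 + |s|) ^ (-1 - α) := by positivity
    have h7 := mul_le_mul_of_nonneg_left h4 hc.le
    rw [h5] at h7
    linarith
  · have h1 : (1 + |s|) ^ (1 + α) ≤ (1 + M) ^ (1 + α) :=
      Real.rpow_le_rpow hs.le (by linarith) (by linarith)
    have h2 : (1 + |s|) ^ (1 + α) * (1 + |s|) ^ (-1 - α) = 1 := by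
      rw [← Real.rpow_add hs]
      ring_nf
      exact Real.rpow_zero _
    have h3 : 0 ≤ (1 + |s|) ^ (-1 - α) := by positivity
    have h4 := mul_le_mul_of_nonneg_right h1 h3
    have h5 : 0 ≤ c * 2 ^ (1 + α) * (1 + |s|) ^ (-1 - α) := by positivity
    linarith [hσ.phi_le_one s]

/-- Uniform boundedness of the zeroth and first discrete absolute moments of `φ_σ`. -/
lemma exists_sum_phi_le (hσ : Admissible σ) {α : ℝ} (hα : 1 < α) (hd : Decay σ α) :
    ∃ K : ℝ, 0 < K ∧ ∀ (t : ℝ) (S : Finset ℤ),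
      ∑ k ∈ S, (1 + |t - k|) * phi σ (t - k) ≤ K := by
  obtain ⟨B, hB, hphi⟩ := hσ.exists_phi_le hα hd
  -- In Lean `0 ^ (-α) = 0`, so the term at j = 0 has to be supplied separately.
  set w : ℤ → ℝ := fun j => B * (|(j : ℝ)| ^ (-α) + if j = 0 then 1 else 0) with hw
  have hw0 : ∀ j, 0 ≤ w j := fun j => by
    simp only [hw]
    split_ifs <;> positivity
  have hws : Summable w :=
    ((Real.summable_abs_int_rpow hα).add (hasSum_ite_eq (0 : ℤ) (1 : ℝ)).summable).mul_left B
  have hle : ∀ s, (1 + |s|) * phi σ s ≤ w ⌊s⌋ := by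
    intro s
    refine (hphi s).trans (mul_le_mul_of_nonneg_left ?_ hB.le)
    by_cases h : ⌊s⌋ = 0
    · rw [if_pos h]
      have h1 : (1 + |s|) ^ (-α) ≤ 1 :=
        Real.rpow_le_one_of_one_le_of_nonpos (by linarith [abs_nonneg s]) (by linarith)
      have h2 : 0 ≤ |((⌊s⌋ : ℤ) : ℝ)| ^ (-α) := by positivity
      linarith
    · rw [if_neg h, add_zero]
      refine Real.rpow_le_rpow_of_nonpos (by positivity) ?_ (by linarith)
      rw [abs_le]
      have := Int.floor_le s
      have := Int.lt_floor_add_one s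
      constructor <;> cases abs_cases s <;> linarith
  refine ⟨∑' j, w j + 1, add_pos_of_nonneg_of_pos (tsum_nonneg hw0) one_pos, fun t S => ?_⟩
  calc ∑ k ∈ S, (1 + |t - k|) * phi σ (t - k) ≤ ∑ k ∈ S, w (⌊t⌋ - k) :=
        Finset.sum_le_sum fun k _ => by
          have := hle (t - k)
          rwa [Int.floor_sub_intCast] at this
    _ = ∑ j ∈ S.map (Equiv.subLeft ⌊t⌋).toEmbedding, w j := by simp
    _ ≤ ∑' j, w j := hws.sum_le_tsum _ fun j _ => hw0 j
    _ ≤ _ := by linarith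

end Admissible

/-! ### Pointwise error estimate. -/

/-- The floor of t serves unless it falls below ⌈a⌉; then t < ⌈a⌉ < a + 1 ≤ t + 1, and length 1
makes ⌈a⌉ admissible. -/
lemma exists_index_near {a b t : ℝ} (hat : a ≤ t) (htb : t ≤ b) (hab : 1 ≤ b - a) :
    ∃ k ∈ Finset.Icc ⌈a⌉ ⌊b⌋, |t - k| ≤ 1 := by
  have h1 := Int.floor_le t
  have h2 := Int.lt_floor_add_one t
  by_cases h : ⌈a⌉ ≤ ⌊t⌋
  · refine ⟨⌊t⌋, Finset.mem_Icc.2 ⟨h, Int.floor_le_floor htb⟩, ?_⟩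
    rw [abs_le]
    constructor <;> linarith
  · have h3 := Int.ceil_lt_add_one a
    refine ⟨⌈a⌉, Finset.mem_Icc.2 ⟨le_rfl, Int.le_floor.2 (by linarith)⟩, ?_⟩
    have h4 : t < ⌈a⌉ := Int.floor_lt.1 (not_le.1 h)
    rw [abs_le]
    constructor <;> linarith

lemma node_mem {a b : Fin 2 → ℝ} {n : ℕ} (hn : 0 < n) {k : Fin 2 → ℤ}
    (hk : k ∈ indexSet a b n) : (fun i => (k i : ℝ) / n) ∈ Set.Icc a b := by
  have hn' : (0 : ℝ) < n := by exact_mod_cast hn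
  simp only [indexSet, Fintype.mem_piFinset, Finset.mem_Icc] at hk
  refine ⟨fun i => ?_, fun i => ?_⟩
  · rw [le_div_iff₀ hn', mul_comm]
    exact Int.ceil_le.1 (hk i).1
  · rw [div_le_iff₀ hn', mul_comm (b i)]
    exact Int.le_floor.1 (hk i).2

/-- The error of `F_n` is controlled by the variation of `f` near `x`, plus the global variation
times the mass `O(1 / (n δ))` that the kernel puts at distance at least `δ / 2`. -/
lemma exists_abs_nnOperator_sub_le {σ : ℝ → ℝ} (hσ : Admissible σ) {α : ℝ} (hα : 1 < α)
    (hd : Decay σ α) (a b : Fin 2 → ℝ) :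
    ∃ K : ℝ, 0 < K ∧ ∀ n : ℕ, 0 < n → (∀ i, 1 ≤ n * b i - n * a i) → ∀ δ : ℝ, 0 < δ →
      ∀ (f : (Fin 2 → ℝ) → ℝ), ∀ x ∈ Set.Icc a b, ∀ A B : ℝ, 0 ≤ A → 0 ≤ B →
      (∀ y ∈ Set.Icc a b, ‖y - x‖ < δ / 2 → |f y - f x| ≤ A) →
      (∀ y ∈ Set.Icc a b, |f y - f x| ≤ B) →
      |nnOperator σ a b n f x - f x| ≤ A + K * B / (n * δ) := by
  obtain ⟨K, hK, hKs⟩ := hσ.exists_sum_phi_le hα hd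
  set c : ℝ := (1 / 2) * (σ 1 - 1 / 2) with hc
  have hc0 : 0 < c := by linarith [hσ.half_lt_map_one]
  refine ⟨2 * K ^ 2 / c ^ 2, by positivity, ?_⟩
  intro n hn hsep δ hδ f x hx A B hA hB hnear hfar
  have hn' : (0 : ℝ) < n := by exact_mod_cast hn
  set P : (Fin 2 → ℤ) → ℝ := fun k => Psi σ (fun i => (n : ℝ) * x i - k i) with hP
  have hP0 : ∀ k, 0 ≤ P k := fun k => Finset.prod_nonneg fun i _ => hσ.phi_nonneg _
  set S := indexSet a b n with hS
  have hden : c ^ 2 ≤ ∑ k ∈ S, P k := by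
    have : ∀ i, ∃ k ∈ Finset.Icc ⌈(n : ℝ) * a i⌉ ⌊(n : ℝ) * b i⌋, |(n : ℝ) * x i - k| ≤ 1 :=
      fun i => exists_index_near (mul_le_mul_of_nonneg_left (hx.1 i) hn'.le)
        (mul_le_mul_of_nonneg_left (hx.2 i) hn'.le) (hsep i)
    choose k hk hk1 using this
    have hkS : k ∈ S := Fintype.mem_piFinset.2 hk
    refine le_trans ?_ (Finset.single_le_sum (fun k _ => hP0 k) hkS)
    calc c ^ 2 = ∏ _i : Fin 2, c := by simp
      _ ≤ P k := Finset.prod_le_prod (fun _ _ => hc0.le) fun i _ => hσ.le_phi (hk1 i)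
  have hden0 : 0 < ∑ k ∈ S, P k := lt_of_lt_of_le (by positivity) hden
  -- A product weight, so that its sum over the index rectangle factors into two univariate moments;
  -- far from x one factor 1 + |n xᵢ - kᵢ| alone exceeds nδ/2.
  set W : (Fin 2 → ℤ) → ℝ := fun k => ∏ i, (1 + |(n : ℝ) * x i - k i|) *
    phi σ ((n : ℝ) * x i - k i) with hW
  have hWsum : ∑ k ∈ S, W k ≤ K ^ 2 := by
    have h1 : ∑ k ∈ S, W k = ∏ i, ∑ j ∈ Finset.Icc ⌈(n : ℝ) * a i⌉ ⌊(n : ℝ) * b i⌋,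
        (1 + |(n : ℝ) * x i - j|) * phi σ ((n : ℝ) * x i - j) := by
      rw [Finset.prod_univ_sum]
      rfl
    rw [h1]
    calc _ ≤ ∏ _i : Fin 2, K := Finset.prod_le_prod
          (fun i _ => Finset.sum_nonneg fun j _ => mul_nonneg (by positivity) (hσ.phi_nonneg _))
          (fun i _ => hKs _ _)
      _ = K ^ 2 := by simp
  have hW0 : ∀ k, 0 ≤ W k := fun k =>
    Finset.prod_nonneg fun i _ => mul_nonneg (by positivity) (hσ.phi_nonneg _)
  have hPW : ∀ k : Fin 2 → ℤ, δ / 2 ≤ ‖(fun i => (k i : ℝ) / n) - x‖ → n * (δ / 2) * P k ≤ W k := by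
    intro k hk
    have h1 : ∃ i, n * (δ / 2) ≤ |(n : ℝ) * x i - k i| := by
      by_contra! h
      refine absurd hk (not_le.2 ((pi_norm_lt_iff (by positivity)).2 fun i => ?_))
      have h2 := h i
      rw [Pi.sub_apply, Real.norm_eq_abs, abs_sub_comm]
      rw [show (n : ℝ) * x i - k i = n * (x i - k i / n) by field_simp, abs_mul,
        abs_of_pos hn'] at h2
      exact lt_of_mul_lt_mul_left h2 hn'.le
    have h2 : n * (δ / 2) ≤ ∏ i, (1 + |(n : ℝ) * x i - k i|) := by
      obtain ⟨i, hi⟩ := h1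
      rw [Fin.prod_univ_two]
      have e0 := abs_nonneg ((n : ℝ) * x 0 - k 0)
      have e1 := abs_nonneg ((n : ℝ) * x 1 - k 1)
      have e2 := mul_nonneg e0 e1
      fin_cases i <;> simp only [Fin.zero_eta, Fin.mk_one] at hi <;> linarith
    have h3 : W k = (∏ i, (1 + |(n : ℝ) * x i - k i|)) * P k := Finset.prod_mul_distrib
    rw [h3]
    exact mul_le_mul_of_nonneg_right h2 (hP0 k)
  have hterm : ∀ k ∈ S, |(f (fun i => (k i : ℝ) / n) - f x) * P k| ≤
      A * P k + B * (2 / (n * δ) * W k) := by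
    intro k hk
    rw [abs_mul, abs_of_nonneg (hP0 k)]
    have hmem := node_mem hn hk
    have e1 : 0 ≤ B * (2 / (n * δ) * W k) := by
      have := hW0 k
      positivity
    have e2 := mul_nonneg hA (hP0 k)
    by_cases h : ‖(fun i => (k i : ℝ) / n) - x‖ < δ / 2
    · have := mul_le_mul_of_nonneg_right (hnear _ hmem h) (hP0 k)
      linarith
    · have h1 := hPW k (not_lt.1 h)
      have h2 : P k ≤ 2 / (n * δ) * W k := by
        rw [div_mul_eq_mul_div, le_div_iff₀ (by positivity)]
        linarith
      have h3 := mul_le_mul (hfar _ hmem) h2 (hP0 k) hB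
      linarith
  have hrep : nnOperator σ a b n f x - f x =
      (∑ k ∈ S, (f (fun i => (k i : ℝ) / n) - f x) * P k) / ∑ k ∈ S, P k := by
    rw [eq_div_iff hden0.ne', sub_mul]
    simp_rw [sub_mul]
    rw [Finset.sum_sub_distrib, ← Finset.mul_sum]
    congr 1
    exact div_mul_cancel₀ _ hden0.ne'
  rw [hrep, abs_div, abs_of_pos hden0, div_le_iff₀ hden0]
  calc |∑ k ∈ S, (f (fun i => (k i : ℝ) / n) - f x) * P k|
      ≤ ∑ k ∈ S, (A * P k + B * (2 / (n * δ) * W k)) :=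
        (Finset.abs_sum_le_sum_abs _ _).trans (Finset.sum_le_sum hterm)
    _ = A * ∑ k ∈ S, P k + B * (2 / (n * δ)) * ∑ k ∈ S, W k := by
        rw [Finset.sum_add_distrib, Finset.mul_sum, Finset.mul_sum]
        congr 1
        exact Finset.sum_congr rfl fun k _ => by ring
    _ ≤ A * ∑ k ∈ S, P k + B * (2 / (n * δ)) * (K ^ 2 / c ^ 2 * ∑ k ∈ S, P k) := by
        gcongr
        refine hWsum.trans ?_
        rw [div_mul_eq_mul_div, le_div_iff₀ (by positivity)]
        gcongr
    _ = _ := by ring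

end NNOp
namespace NNOp

/-! ### Global oscillation and averages of the local modulus. -/

lemma euclNorm_le_two_mul_norm (h : Fin 2 → ℝ) : euclNorm h ≤ 2 * ‖h‖ := by
  refine Real.sqrt_le_iff.2 ⟨by positivity, ?_⟩
  have hi : ∀ i, h i ^ 2 ≤ ‖h‖ ^ 2 := fun i =>
    sq_le_sq' (by linarith [neg_abs_le (h i), norm_le_pi_norm h i, Real.norm_eq_abs (h i)])
      ((le_abs_self _).trans (norm_le_pi_norm h i))
  rw [Fin.sum_univ_two]
  nlinarith [hi 0, hi 1, sq_nonneg ‖h‖]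

lemma euclNorm_pos {h : Fin 2 → ℝ} (hh : h ≠ 0) : 0 < euclNorm h := by
  obtain ⟨i, hi⟩ := Function.ne_iff.1 hh
  refine Real.sqrt_pos.2 (Finset.sum_pos' (fun j _ => sq_nonneg _) ⟨i, Finset.mem_univ _, ?_⟩)
  exact sq_pos_of_ne_zero hi

/-- A function whose values at points of a box at distance at most `r` differ by at most `E` has
oscillation at most `(diam / r + 1) E` on the box. -/
lemma abs_sub_le_of_small_steps {a b : Fin 2 → ℝ} {f : (Fin 2 → ℝ) → ℝ} {r E : ℝ} (hr : 0 < r)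
    (hE : 0 ≤ E)
    (h : ∀ u ∈ Set.Icc a b, ∀ v ∈ Set.Icc a b, ‖u - v‖ ≤ r → |f u - f v| ≤ E)
    {x y : Fin 2 → ℝ} (hx : x ∈ Set.Icc a b) (hy : y ∈ Set.Icc a b) :
    |f y - f x| ≤ (‖b - a‖ / r + 1) * E := by
  have hab : ‖y - x‖ ≤ ‖b - a‖ := by
    refine (pi_norm_le_iff_of_nonneg (norm_nonneg _)).2 fun i => ?_
    refine le_trans ?_ (norm_le_pi_norm (b - a) i)
    simp only [Pi.sub_apply, Real.norm_eq_abs]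
    refine le_trans ?_ (le_abs_self _)
    rw [abs_le]
    constructor <;> linarith [hx.1 i, hx.2 i, hy.1 i, hy.2 i]
  set M : ℕ := ⌊‖b - a‖ / r⌋₊ + 1 with hM
  have hM0 : (0 : ℝ) < M := by positivity
  have hMle : (M : ℝ) ≤ ‖b - a‖ / r + 1 := by
    rw [hM]
    push_cast
    linarith [Nat.floor_le (show 0 ≤ ‖b - a‖ / r by positivity)]
  have hMge : ‖b - a‖ / r ≤ M := by
    rw [hM]
    push_cast
    exact (Nat.lt_floor_add_one _).le
  set z : ℕ → Fin 2 → ℝ := fun j => AffineMap.lineMap x y ((j : ℝ) / M) with hz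
  have hzmem : ∀ j ≤ M, z j ∈ Set.Icc a b := fun j hj =>
    (convex_Icc a b).lineMap_mem hx hy
      ⟨by positivity, (div_le_one hM0).2 (by exact_mod_cast hj)⟩
  have hstep : ∀ j, ‖z (j + 1) - z j‖ ≤ r := by
    intro j
    have : z (j + 1) - z j = (1 / (M : ℝ)) • (y - x) := by
      ext i
      simp only [hz, AffineMap.lineMap_apply_module', Pi.sub_apply, Pi.add_apply, Pi.smul_apply,
        smul_eq_mul]
      push_cast
      ring
    rw [this, norm_smul, Real.norm_of_nonneg (by positivity), one_div_mul_eq_div, div_le_iff₀ hM0]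
    rw [div_le_iff₀ hr] at hMge
    linarith
  have hind : ∀ j ≤ M, |f (z j) - f x| ≤ j * E := by
    intro j
    induction j with
    | zero => intro _; simp [hz]
    | succ j ih =>
      intro hj
      have h1 := ih (by omega)
      have h2 := h _ (hzmem (j + 1) hj) _ (hzmem j (by omega)) (hstep j)
      have h3 := abs_sub_le (f (z (j + 1))) (f (z j)) (f x)
      push_cast
      linarith
  have hlast : z M = y := by
    simp only [hz]
    rw [div_self hM0.ne', AffineMap.lineMap_apply_one]
  have := hind M le_rfl
  rw [hlast] at this
  exact this.trans (mul_le_mul_of_nonneg_right hMle hE)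

lemma ofReal_sq_le_volume_inter_ball {a b u : Fin 2 → ℝ} {r : ℝ} (hr : 0 < r)
    (hrab : ∀ i, r ≤ b i - a i) (hu : u ∈ Set.Icc a b) :
    ENNReal.ofReal (r ^ 2) ≤ volume (Set.Icc a b ∩ Metric.ball u r) := by
  -- Lower corner of a cube of side r near u, pushed back where u is too close to the upper faces.
  set c : Fin 2 → ℝ := fun i => min (u i) (b i - r) with hc
  have hsub : (Set.univ.pi fun i => Set.Ioo (c i) (c i + r)) ⊆
      Set.Icc a b ∩ Metric.ball u r := by
    intro w hw
    have h1 : ∀ i, c i < w i ∧ w i < c i + r := fun i => hw i (Set.mem_univ i)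
    have h2 : ∀ i, a i ≤ c i := fun i => le_min (hu.1 i) (by linarith [hrab i])
    have h3 : ∀ i, u i - r ≤ c i := fun i => le_min (by linarith) (by linarith [hu.2 i])
    have h4 : ∀ i, c i ≤ u i := fun i => min_le_left _ _
    have h5 : ∀ i, c i ≤ b i - r := fun i => min_le_right _ _
    refine ⟨⟨fun i => by linarith [h1 i, h2 i], fun i => by linarith [h1 i, h5 i]⟩, ?_⟩
    refine (dist_pi_lt_iff hr).2 fun i => ?_
    rw [Real.dist_eq, abs_lt]
    constructor <;> linarith [h1 i, h3 i, h4 i]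
  refine le_trans (le_of_eq ?_) (measure_mono hsub)
  rw [Real.volume_pi_Ioo]
  simp [ENNReal.ofReal_pow hr.le]

/-- A lower semicontinuous minorant of the local modulus: the points `u`, `v` range over the open
balls of radius `δ / 2` around `x`. -/
noncomputable def openLocalModulus (a b : Fin 2 → ℝ) (f : (Fin 2 → ℝ) → ℝ) (δ : ℝ)
    (x : Fin 2 → ℝ) : ℝ≥0∞ :=
  ⨆ q : (Fin 2 → ℝ) × (Fin 2 → ℝ),
    ⨆ _ : q.1 ∈ Set.Icc a b ∧ q.2 ∈ Set.Icc a b ∧ euclNorm (q.2 - q.1) ≤ δ,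
      (Metric.ball q.1 (δ / 2) ∩ Metric.ball q.2 (δ / 2)).indicator
        (fun _ => ENNReal.ofReal |f q.2 - f q.1|) x

/-- The supremum is uncountable, but indicators of open sets are lower semicontinuous and suprema
preserve this. -/
lemma measurable_openLocalModulus (a b : Fin 2 → ℝ) (f : (Fin 2 → ℝ) → ℝ) (δ : ℝ) :
    Measurable (openLocalModulus a b f δ) :=
  (lowerSemicontinuous_biSup fun _ _ =>
    (Metric.isOpen_ball.inter Metric.isOpen_ball).lowerSemicontinuous_indicator
      zero_le).measurable

lemma le_openLocalModulus {a b : Fin 2 → ℝ} (f : (Fin 2 → ℝ) → ℝ) {δ : ℝ}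
    {x u v : Fin 2 → ℝ} (hu : u ∈ Set.Icc a b) (hv : v ∈ Set.Icc a b) (huv : euclNorm (v - u) ≤ δ)
    (hux : ‖u - x‖ < δ / 2) (hvx : ‖v - x‖ < δ / 2) :
    ENNReal.ofReal |f v - f u| ≤ openLocalModulus a b f δ x := by
  refine le_trans ?_ (le_iSup₂_of_le (u, v) ⟨hu, hv, huv⟩ le_rfl)
  rw [Set.indicator_of_mem]
  exact ⟨by rwa [Metric.mem_ball', dist_eq_norm], by rwa [Metric.mem_ball', dist_eq_norm]⟩

lemma openLocalModulus_le {a b : Fin 2 → ℝ} {f : (Fin 2 → ℝ) → ℝ} {B : ℝ}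
    (hB : ∀ x ∈ Set.Icc a b, |f x| ≤ B) (δ : ℝ) (x : Fin 2 → ℝ) :
    openLocalModulus a b f δ x ≤ ENNReal.ofReal (localModulus a b f δ x) := by
  refine iSup₂_le fun q hq => Set.indicator_apply_le' (fun hx => ENNReal.ofReal_le_ofReal ?_)
    fun _ => zero_le
  obtain ⟨h1, h2, h3⟩ := hq
  by_cases h : q.2 - q.1 = 0
  · rw [sub_eq_zero.1 h, sub_self, abs_zero]
    refine Real.sSup_nonneg ?_
    rintro r ⟨u, h, -, -, -, -, -, -, rfl⟩
    exact abs_nonneg _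
  · refine le_csSup ⟨2 * B, ?_⟩ ⟨q.1, q.2 - q.1, euclNorm_pos h, h3, h1, ?_, ?_, ?_, ?_⟩
    · rintro r ⟨u, h, -, -, hu, hv, -, -, rfl⟩
      linarith [abs_sub (f (u + h)) (f u), hB _ hu, hB _ hv]
    · rwa [add_sub_cancel]
    · have := hx.1
      rw [Metric.mem_ball', dist_eq_norm] at this
      exact this.le
    · have := hx.2
      rw [Metric.mem_ball', dist_eq_norm] at this
      rw [add_sub_cancel]
      exact this.le
    · rw [add_sub_cancel]

lemma openLocalModulus_le_two_mul {a b : Fin 2 → ℝ} {f : (Fin 2 → ℝ) → ℝ} {B : ℝ}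
    (hB : ∀ x ∈ Set.Icc a b, |f x| ≤ B) (δ : ℝ) (x : Fin 2 → ℝ) :
    openLocalModulus a b f δ x ≤ ENNReal.ofReal (2 * B) :=
  iSup₂_le fun q hq => Set.indicator_apply_le' (fun _ => ENNReal.ofReal_le_ofReal
    (by linarith [abs_sub (f q.2) (f q.1), hB _ hq.1, hB _ hq.2.1])) fun _ => zero_le

lemma le_modulus {a b : Fin 2 → ℝ} {f : (Fin 2 → ℝ) → ℝ} {B δ : ℝ}
    (hB : ∀ x ∈ Set.Icc a b, |f x| ≤ B) {u v : Fin 2 → ℝ} (hu : u ∈ Set.Icc a b)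
    (hv : v ∈ Set.Icc a b) (huv : euclNorm (u - v) ≤ δ) : |f u - f v| ≤ modulus a b f δ := by
  refine le_csSup ⟨2 * B, ?_⟩ ⟨u, hu, v, hv, huv, rfl⟩
  rintro r ⟨u, hu, v, hv, -, rfl⟩
  linarith [abs_sub (f u) (f v), hB _ hu, hB _ hv]

lemma modulus_nonneg (a b : Fin 2 → ℝ) (f : (Fin 2 → ℝ) → ℝ) (δ : ℝ) : 0 ≤ modulus a b f δ := by
  refine Real.sSup_nonneg ?_
  rintro r ⟨u, -, v, -, -, rfl⟩
  exact abs_nonneg _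

/-- The variation of `f` between close points is an average of the local modulus. -/
lemma abs_sub_mul_sq_le_lintegral {a b : Fin 2 → ℝ} (f : (Fin 2 → ℝ) → ℝ) {δ : ℝ} (hδ : 0 < δ)
    (hδab : ∀ i, δ / 4 ≤ b i - a i) {u v : Fin 2 → ℝ} (hu : u ∈ Set.Icc a b)
    (hv : v ∈ Set.Icc a b) (huv : ‖u - v‖ ≤ δ / 4) :
    ENNReal.ofReal (|f u - f v| * (δ / 4) ^ 2) ≤
      ∫⁻ x in Set.Icc a b, openLocalModulus a b f δ x := by
  rw [ENNReal.ofReal_mul (abs_nonneg _)]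
  calc ENNReal.ofReal |f u - f v| * ENNReal.ofReal ((δ / 4) ^ 2)
      ≤ ENNReal.ofReal |f u - f v| * volume (Set.Icc a b ∩ Metric.ball u (δ / 4)) := by
        gcongr
        exact ofReal_sq_le_volume_inter_ball (by positivity) hδab hu
    _ = ∫⁻ _ in Set.Icc a b ∩ Metric.ball u (δ / 4), ENNReal.ofReal |f u - f v| := by
        rw [setLIntegral_const]
    _ ≤ ∫⁻ x in Set.Icc a b ∩ Metric.ball u (δ / 4), openLocalModulus a b f δ x := by
        refine setLIntegral_mono (measurable_openLocalModulus a b f δ) fun w hw => ?_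
        -- With v within δ/4 of u, both points lie within δ/2 of w, so the pair competes in the
        -- modulus at w.
        have hw2 : ‖u - w‖ < δ / 4 := by
          have := hw.2
          rwa [Metric.mem_ball', dist_eq_norm] at this
        have h3 : ‖v - w‖ ≤ ‖v - u‖ + ‖u - w‖ := norm_sub_le_norm_sub_add_norm_sub v u w
        rw [norm_sub_rev v u] at h3
        exact le_openLocalModulus f hv hu (by linarith [euclNorm_le_two_mul_norm (u - v)])
          (by linarith) (by linarith)
    _ ≤ _ := lintegral_mono_set Set.inter_subset_left

/-- Minkowski, then Hölder for the L¹ norm of g: the exponents 1 - 1/p and 1/p of the total mass add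
up to 1, so the factor does not depend on p. -/
lemma eLpNorm_add_const_lintegral_le {X : Type*} [MeasurableSpace X] {μ : Measure X}
    {g : X → ℝ≥0∞} (hg : Measurable g) {p : ℝ≥0∞} (hp : 1 ≤ p) (c : ℝ≥0∞) :
    eLpNorm (fun x => g x + c * ∫⁻ y, g y ∂μ) p μ ≤ (1 + c * μ Set.univ) * eLpNorm g p μ := by
  rcases eq_or_ne μ 0 with rfl | hμ
  · simp
  have hp0 : p ≠ 0 := (zero_lt_one.trans_le hp).ne'
  have h1 : ∫⁻ y, g y ∂μ ≤ eLpNorm g p μ * μ Set.univ ^ (1 - 1 / p.toReal) := by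
    have := eLpNorm_le_eLpNorm_mul_rpow_measure_univ (μ := μ) hp hg.aestronglyMeasurable
    simpa [eLpNorm_one_eq_lintegral_enorm] using this
  have hexp : 0 ≤ 1 - 1 / p.toReal := by
    rcases eq_or_ne p ∞ with rfl | hpt
    · simp
    · have : 1 ≤ p.toReal := by
        rwa [← ENNReal.toReal_one, ENNReal.toReal_le_toReal ENNReal.one_ne_top hpt]
      rw [sub_nonneg, div_le_one (by linarith)]
      exact this
  refine (eLpNorm_add_le hg.aestronglyMeasurable aestronglyMeasurable_const hp).trans ?_
  rw [eLpNorm_const _ hp0 hμ, add_mul, one_mul, enorm_eq_self]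
  refine add_le_add_right ?_ _
  calc c * (∫⁻ y, g y ∂μ) * μ Set.univ ^ (1 / p.toReal)
      ≤ c * (eLpNorm g p μ * μ Set.univ ^ (1 - 1 / p.toReal)) * μ Set.univ ^ (1 / p.toReal) := by
        gcongr
    _ = c * (μ Set.univ ^ (1 - 1 / p.toReal) * μ Set.univ ^ (1 / p.toReal)) * eLpNorm g p μ := by
        ring
    _ = c * μ Set.univ * eLpNorm g p μ := by
        rw [← ENNReal.rpow_add_of_nonneg _ _ hexp (by positivity), sub_add_cancel,
          ENNReal.rpow_one]

end NNOp

/-! ### The estimates combined at δ = n^(-1/4). -/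

theorem theorem5p3 (σ : ℝ → ℝ) (hσ : NNOp.Admissible σ)
    (α : ℝ) (hα : 1 < α) (hdecay : NNOp.Decay σ α)
    (a b : Fin 2 → ℝ) (hab : ∀ i, a i < b i) :
    ∃ C : ℝ, 0 < C ∧ ∃ N : ℕ, ∀ f ∈ NNOp.boundedMeasurable a b, ∀ n : ℕ, N ≤ n →
      (∀ p : ℝ≥0∞, 1 ≤ p →
        eLpNorm (fun x => NNOp.nnOperator σ a b n f x - f x) p (volume.restrict (Set.Icc a b)) ≤
          ENNReal.ofReal C * NNOp.tau a b f ((n : ℝ) ^ (-(1 / 4) : ℝ)) p) ∧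
      (∀ x ∈ Set.Icc a b,
        |NNOp.nnOperator σ a b n f x - f x| ≤
          C * NNOp.modulus a b f ((n : ℝ) ^ (-(1 / 4) : ℝ))) := by
  obtain ⟨K, hK, hest⟩ := NNOp.exists_abs_nnOperator_sub_le hσ hα hdecay a b
  set D : ℝ := ‖b - a‖ with hD
  have hD0 : 0 ≤ D := norm_nonneg _
  set V : ℝ := (volume (Set.Icc a b)).toReal with hV
  have hV0 : 0 ≤ V := ENNReal.toReal_nonneg
  have hVfin : volume (Set.Icc a b) ≠ ∞ := isCompact_Icc.measure_lt_top.ne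
  -- 16 comes from averaging over cubes of side δ/4, and 4D + 1 from the number of steps of length
  -- δ/4.
  set K₁ : ℝ := 16 * K * (4 * D + 1) with hK₁
  have hK₁0 : 0 < K₁ := by positivity
  obtain ⟨N, hN⟩ : ∃ N : ℕ, ∀ n : ℕ, N ≤ n → 0 < n ∧ (∀ i, 1 ≤ n * b i - n * a i) ∧
      ∀ i, (n : ℝ) ^ (-(1 / 4) : ℝ) / 4 ≤ b i - a i := by
    refine eventually_atTop.1 ((eventually_gt_atTop 0).and (.and ?_ ?_))
    · refine eventually_all.2 fun i => ?_
      have := (tendsto_natCast_atTop_atTop (R := ℝ)).atTop_mul_const (sub_pos.2 (hab i))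
      filter_upwards [this.eventually_ge_atTop 1] with n hn
      linarith
    · refine eventually_all.2 fun i => ?_
      have h1 := (tendsto_rpow_neg_atTop (show (0 : ℝ) < 1 / 4 by norm_num)).comp
        (tendsto_natCast_atTop_atTop (R := ℝ))
      have h2 := hab i
      filter_upwards [h1.eventually_le_const
        (show (0 : ℝ) < 4 * (b i - a i) by linarith)] with n hn
      simp only [Function.comp_apply] at hn
      linarith
  refine ⟨1 + K₁ * V + K₁, by positivity, N, fun f hf n hn => ?_⟩
  obtain ⟨-, B, hB⟩ := hf
  obtain ⟨hn0, hsep, hside⟩ := hN n hn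
  have hn' : (1 : ℝ) ≤ n := by exact_mod_cast hn0
  set δ : ℝ := (n : ℝ) ^ (-(1 / 4) : ℝ) with hδdef
  have hδ : 0 < δ := by positivity
  have hδ1 : δ ≤ 1 := Real.rpow_le_one_of_one_le_of_nonpos hn' (by norm_num)
  have hnδ : n * δ ^ 4 = 1 := by
    rw [hδdef, ← Real.rpow_natCast, ← Real.rpow_mul (by positivity)]
    norm_num
    rw [Real.rpow_neg_one, mul_inv_cancel₀ (by positivity)]
  have hnear_le : ∀ {x y : Fin 2 → ℝ}, ‖y - x‖ < δ / 2 → NNOp.euclNorm (y - x) ≤ δ :=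
    fun {x y} h => by linarith [NNOp.euclNorm_le_two_mul_norm (y - x)]
  have hfac : D / (δ / 4) + 1 ≤ (4 * D + 1) / δ := by
    rw [le_div_iff₀ hδ]
    have : D / (δ / 4) * δ = 4 * D := by field_simp
    linarith
  constructor
  · intro p hp
    set g := NNOp.openLocalModulus a b f δ with hg
    set μ := volume.restrict (Set.Icc a b) with hμ
    have hgm : Measurable g := NNOp.measurable_openLocalModulus a b f δ
    have hgfin : ∀ x, g x ≠ ∞ := fun x =>
      ne_top_of_le_ne_top ENNReal.ofReal_ne_top (NNOp.openLocalModulus_le hB δ x)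
    have hgle : eLpNorm g p μ ≤ NNOp.tau a b f δ p := by
      refine eLpNorm_mono_enorm fun x => (NNOp.openLocalModulus_le hB δ x).trans ?_
      exact ENNReal.ofReal_le_ofReal (le_abs_self _) |>.trans (by simp [← ofReal_norm])
    have hGfin : ∫⁻ y, g y ∂μ ≠ ∞ := by
      refine ((lintegral_mono fun x => NNOp.openLocalModulus_le_two_mul hB δ x).trans_lt ?_).ne
      rw [lintegral_const, hμ, Measure.restrict_apply_univ]
      exact ENNReal.mul_lt_top ENNReal.ofReal_lt_top hVfin.lt_top
    set G : ℝ := (∫⁻ y, g y ∂μ).toReal with hG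
    have hG0 : 0 ≤ G := ENNReal.toReal_nonneg
    have hpt : ∀ x ∈ Set.Icc a b, ‖NNOp.nnOperator σ a b n f x - f x‖ₑ ≤
        g x + ENNReal.ofReal K₁ * ∫⁻ y, g y ∂μ := by
      intro x hx
      have hstep : ∀ u ∈ Set.Icc a b, ∀ v ∈ Set.Icc a b, ‖u - v‖ ≤ δ / 4 →
          |f u - f v| ≤ 16 * G / δ ^ 2 := by
        intro u hu v hv huv
        have := ENNReal.toReal_mono hGfin (NNOp.abs_sub_mul_sq_le_lintegral f hδ hside hu hv huv)
        rw [ENNReal.toReal_ofReal (by positivity)] at this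
        rw [le_div_iff₀ (by positivity)]
        linarith
      have hosc := fun y hy =>
        (NNOp.abs_sub_le_of_small_steps (by positivity) (by positivity) hstep hx
          (y := y) hy).trans (mul_le_mul_of_nonneg_right hfac (by positivity))
      have hmain := hest n hn0 hsep δ hδ f x hx (g x).toReal _ ENNReal.toReal_nonneg
        (by positivity) (fun y hy hyx => by
          have := ENNReal.toReal_mono (hgfin x) (NNOp.le_openLocalModulus f hx hy
            (hnear_le hyx) (by simpa using hδ) hyx)
          rwa [ENNReal.toReal_ofReal (abs_nonneg _)] at this) hosc
      -- The powers of 1/δ are one from the chain, two from the averaging and one from the moment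
      -- bound; they cancel n exactly.
      have hconst : K * ((4 * D + 1) / δ * (16 * G / δ ^ 2)) / (n * δ) = K₁ * G := by
        have : K * ((4 * D + 1) / δ * (16 * G / δ ^ 2)) / (n * δ) = K₁ * G / (n * δ ^ 4) := by
          rw [hK₁]
          field_simp
        rw [this, hnδ, div_one]
      rw [hconst] at hmain
      rw [← ofReal_norm, Real.norm_eq_abs]
      refine (ENNReal.ofReal_le_ofReal hmain).trans (le_of_eq ?_)
      rw [ENNReal.ofReal_add ENNReal.toReal_nonneg (by positivity), ENNReal.ofReal_mul hK₁0.le,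
        ENNReal.ofReal_toReal (hgfin x), ENNReal.ofReal_toReal hGfin]
    calc eLpNorm (fun x => NNOp.nnOperator σ a b n f x - f x) p μ
        ≤ eLpNorm (fun x => g x + ENNReal.ofReal K₁ * ∫⁻ y, g y ∂μ) p μ :=
          eLpNorm_mono_enorm_ae ((ae_restrict_mem measurableSet_Icc).mono hpt)
      _ ≤ (1 + ENNReal.ofReal K₁ * μ Set.univ) * eLpNorm g p μ :=
          NNOp.eLpNorm_add_const_lintegral_le hgm hp _
      _ ≤ ENNReal.ofReal (1 + K₁ * V + K₁) * NNOp.tau a b f δ p := by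
          gcongr
          rw [hμ, Measure.restrict_apply_univ, ← ENNReal.ofReal_toReal hVfin, ← hV,
            ← ENNReal.ofReal_mul hK₁0.le, ← ENNReal.ofReal_one,
            ← ENNReal.ofReal_add one_pos.le (by positivity)]
          exact ENNReal.ofReal_le_ofReal (by linarith)
  · intro x hx
    set m := NNOp.modulus a b f δ with hm
    have hm0 : 0 ≤ m := NNOp.modulus_nonneg a b f δ
    have hstep : ∀ u ∈ Set.Icc a b, ∀ v ∈ Set.Icc a b, ‖u - v‖ ≤ δ / 4 → |f u - f v| ≤ m :=
      fun u hu v hv huv => NNOp.le_modulus hB hu hv (hnear_le (by linarith))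
    have hosc := fun y hy =>
      (NNOp.abs_sub_le_of_small_steps (by positivity) hm0 hstep hx (y := y) hy).trans
        (mul_le_mul_of_nonneg_right hfac hm0)
    have hmain := hest n hn0 hsep δ hδ f x hx m _ hm0 (by positivity)
      (fun y hy hyx => NNOp.le_modulus hB hy hx (hnear_le hyx)) hosc
    -- Without averaging only δ² appears, so there is room to spare.
    have hnδ2 : 1 ≤ n * δ ^ 2 := by
      rw [← hnδ]
      gcongr ?_ * ?_
      exact pow_le_pow_of_le_one hδ.le hδ1 (by norm_num)
    have hconst : K * ((4 * D + 1) / δ * m) / (n * δ) ≤ K₁ * m := by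
      have : K * ((4 * D + 1) / δ * m) / (n * δ) = K * (4 * D + 1) * m / (n * δ ^ 2) := by
        field_simp
      rw [this, hK₁]
      have h0 : 0 ≤ K * (4 * D + 1) * m := by positivity
      refine (div_le_self h0 hnδ2).trans ?_
      linarith
    have : 0 ≤ K₁ * V * m := by positivity
    linarith
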